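/- Let $(X,d)$ be a connected and locally path connected metric space with base point $x_0\in X$. A covering space $p\colon Y\to X$ is *trivial over* a subset $Z\subseteq X$ if $p^{-1}(Z)$ is a disjoint union of open subspaces of $p^{-1}(Z)$, each of which is mapped homeomorphically onto $Z$ by $p$; it is *trivial* if it is trivial over $X$. For $\delta\in[0,\infty]$ it is *$\delta$-trivial* if it is trivial over every open ball of radius $\delta$ in $X$ (a ball of radius $\infty$ being all of $X$), and its *covering radius* is $$r(Y/X)=\sup\{\delta\in[0,\infty] : Y \text{ is } \delta\text{-trivial over } X\}.$$ The *covering spectrum* $\operatorname{CovSpec}(X)\subseteq[0,\infty]$ is the set of all $r(Y/X)$, where $Y$ ranges over the non-trivial covering spaces of $X$ of constant degree (that is, all fibres have the same, possibly infinite, cardinality). For a real number $\delta>0$ let $\operatorname{Fil}^\delta\pi_1(X,x_0)$ be the subgroup of $\pi_1(X,x_0)$ generated by the classes $[\alpha*\sigma*\overline{\alpha}]$, where $\sigma$ is a loop contained in some open ball of radius $\delta$ in $X$ and $\alpha$ is a path from $x_0$ to $\sigma(0)$, with inverse path $\overline\alpha$ (equivalently, generated by the classes of loops at $x_0$ that are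 freely homotopic to a loop contained in some open ball of radius $\delta$). The *jump set* of this filtration is $$\operatorname{Jump}(\operatorname{Fil}^\bullet\pi_1(X,x_0))=\{\delta>0 : \operatorname{Fil}^\delta\pi_1(X,x_0)\neq\operatorname{Fil}^\varepsilon\pi_1(X,x_0)\text{ for all real } \varepsilon>\delta\}.$$ Then $$\operatorname{CovSpec}(X)\setminus\{0\}=\operatorname{Jump}(\operatorname{Fil}^\bullet\pi_1(X,x_0)).$$ In particular, $\infty\notin\operatorname{CovSpec}(X)$. -/

import Mathlib

open Set
open scoped ENNReal

universe u

namespace CovSpectrum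

/-- The space `Y` over `X` (with structure map `p`) is trivial over `Z ⊆ X`: the preimage `p⁻¹(Z)`
is a disjoint union of open subspaces of `p⁻¹(Z)`, each mapped homeomorphically onto `Z` by `p`. -/
def TrivialOver {X Y : Type*} [TopologicalSpace X] [TopologicalSpace Y] (p : Y → X)
    (Z : Set X) : Prop :=
  ∃ S : Set (Set Y), S.PairwiseDisjoint id ∧ ⋃₀ S = p ⁻¹' Z ∧
    ∀ V ∈ S, IsOpen ((↑) ⁻¹' V : Set (p ⁻¹' Z)) ∧ ∃ e : V ≃ₜ Z, ∀ y : V, (e y : X) = p y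

/-- `Y` is `δ`-trivial over the metric space `X`, for `δ ∈ [0, ∞]`: it is trivial over each open
ball of radius `δ` (the ball of radius `∞` is all of `X`). -/
def DeltaTrivial {X Y : Type*} [MetricSpace X] [TopologicalSpace Y] (p : Y → X)
    (δ : ℝ≥0∞) : Prop :=
  ∀ x : X, TrivialOver p (Metric.eball x δ)

/-- The covering radius `r(Y/X) ∈ [0, ∞]`. -/
noncomputable def covRadius {X Y : Type*} [MetricSpace X] [TopologicalSpace Y] (p : Y → X) :
    ℝ≥0∞ :=
  sSup {δ : ℝ≥0∞ | DeltaTrivial p δ}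

/-- All fibres of `p` have the same (possibly infinite) cardinality. -/
def ConstantDegree {X Y : Type*} (p : Y → X) : Prop :=
  ∀ x x' : X, Nonempty (p ⁻¹' {x} ≃ p ⁻¹' {x'})

/-- The covering spectrum of `X`: the set of all covering radii of non-trivial coverings of `X`
of constant degree. -/
def CovSpec (X : Type u) [MetricSpace X] : Set ℝ≥0∞ :=
  {r | ∃ (Y : Type u) (_ : TopologicalSpace Y) (p : Y → X),
    IsCoveringMap p ∧ ConstantDegree p ∧ ¬ TrivialOver p univ ∧ covRadius p = r}

/-- The jump set of a filtration (an increasing family of subgroups indexed by an ordered set). -/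
def Jump {I G : Type*} [LinearOrder I] [Group G] (F : I →o Subgroup G) : Set I :=
  {i | ∀ j, i < j → F i ≠ F j}

/-- The classes `[α * σ * α⁻¹]` in `π₁(X, x₀)`, where `σ` is a loop contained in some open ball of
radius `δ` and `α` is a path from `x₀` to the base point of `σ`. -/
def smallClasses {X : Type*} [MetricSpace X] (x₀ : X) (δ : ℝ) : Set (FundamentalGroup X x₀) :=
  {g | ∃ (x c : X) (α : Path x₀ x) (σ : Path x x), range σ ⊆ Metric.ball c δ ∧
    g = FundamentalGroup.fromPath (Path.Homotopic.Quotient.mk ((α.trans σ).trans α.symm))}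

theorem smallClasses_mono {X : Type*} [MetricSpace X] (x₀ : X) {δ ε : ℝ} (h : δ ≤ ε) :
    smallClasses x₀ δ ⊆ smallClasses x₀ ε := by
  rintro g ⟨x, c, α, σ, hσ, rfl⟩
  exact ⟨x, c, α, σ, hσ.trans (Metric.ball_subset_ball h), rfl⟩

/-- The filtration `Fil^δ π₁(X, x₀)`, indexed by the positive real numbers `δ`: the subgroup
generated by the classes `smallClasses x₀ δ`. -/
noncomputable def fil {X : Type*} [MetricSpace X] (x₀ : X) :
    Ioi (0 : ℝ) →o Subgroup (FundamentalGroup X x₀) where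
  toFun δ := Subgroup.closure (smallClasses x₀ (δ : ℝ))
  monotone' _ _ h := Subgroup.closure_mono (smallClasses_mono x₀ h)

end CovSpectrum

open Topology

/-! A covering is trivial over an open set exactly when every loop in that set acts trivially by
monodromy. Hence it is `δ`-trivial iff `Fil^δ` lies in the kernel `K` of its monodromy on the fibre
over `x₀` (`deltaTrivial_ofReal_iff`).

A loop is compact, so a nonzero covering radius `r` is attained; it is finite unless the covering is
trivial. If `Fil^r = Fil^ε` with `ε > r`, then `Fil^ε ≤ K` would give a larger radius; so `r` is a
jump.

Conversely, `coverCore` is a covering with fibre `π₁ / Fil^δ` whose kernel is exactly `Fil^δ`. It is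
`ε`-trivial iff `Fil^ε ≤ Fil^δ`, which at a jump `δ` fails for every `ε > δ`, so its radius is `δ`.
-/

/-- The total space of a local homeomorphism to a locally path connected space is locally path
connected. -/
theorem IsLocalHomeomorph.locallyPathConnectedSpace {X Y : Type*} [TopologicalSpace X]
    [TopologicalSpace Y] [LocallyPathConnectedSpace X] {p : Y → X} (hp : IsLocalHomeomorph p) :
    LocallyPathConnectedSpace Y := by
  rw [locallyPathConnectedSpace_iff_pathComponentIn_mem_nhds]
  intro y F hF hy
  obtain ⟨U, hU, hemb⟩ := isLocalHomeomorph_iff_isOpenEmbedding_restrict.mp hp y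
  have := hemb.locallyPathConnectedSpace
  have hyU : y ∈ U := mem_of_mem_nhds hU
  have hF' : IsOpen ((↑) ⁻¹' F : Set U) := hF.preimage continuous_subtype_val
  have hmem : pathComponentIn ((↑) ⁻¹' F : Set U) ⟨y, hyU⟩ ∈ 𝓝 (⟨y, hyU⟩ : U) :=
    (hF'.pathComponentIn _).mem_nhds (mem_pathComponentIn_self hy)
  have himg := (map_nhds_subtype_coe_eq_nhds hyU hU) ▸ Filter.image_mem_map hmem
  refine Filter.mem_of_superset himg ?_
  rintro _ ⟨z, hz, rfl⟩
  obtain ⟨γ, hγ⟩ := hz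
  exact ⟨γ.map continuous_subtype_val, fun t => hγ t⟩

/-! ### Monodromy and triviality over subsets -/

namespace IsCoveringMap

variable {X Y : Type*} [TopologicalSpace X] [TopologicalSpace Y] {p : Y → X}
  (cov : IsCoveringMap p)

theorem monodromy_symm_trans_apply {x y : X} (γ : Path.Homotopic.Quotient x y) (e) :
    cov.monodromy γ.symm (cov.monodromy γ e) = e := by
  rw [← cov.monodromy_trans_apply, Path.Homotopic.Quotient.trans_symm, cov.monodromy_refl, id]

theorem monodromy_conj_eq_id_iff {x y : X} (α : Path.Homotopic.Quotient x y)
    (σ : Path.Homotopic.Quotient y y) :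
    cov.monodromy ((α.trans σ).trans α.symm) = id ↔ cov.monodromy σ = id := by
  constructor
  · intro h
    funext e
    obtain ⟨e, rfl⟩ := (cov.monodromy_bijective α).2 e
    have he := congrFun h e
    rw [cov.monodromy_trans_apply, cov.monodromy_trans_apply] at he
    apply (cov.monodromy_bijective α.symm).1
    rw [he]
    simp only [id, monodromy_symm_trans_apply]
  · intro h
    funext e
    rw [cov.monodromy_trans_apply, cov.monodromy_trans_apply, h, id,
      monodromy_symm_trans_apply, id]

include cov in
/-- A covering of a path connected space has constant degree. -/
theorem constantDegree [PathConnectedSpace X] : CovSpectrum.ConstantDegree p := fun x x' =>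
  ⟨Equiv.ofBijective _ (cov.monodromy_bijective (.mk (PathConnectedSpace.somePath x x')))⟩

/-- A loop in a set over which a covering is trivial has trivial monodromy. -/
theorem monodromy_eq_id_of_trivialOver {B : Set X} (h : CovSpectrum.TrivialOver p B) {x : X}
    (σ : Path x x) (hσ : range σ ⊆ B) : cov.monodromy (.mk σ) = id := by
  obtain ⟨S, hdisj, hcover, hS⟩ := h
  funext e
  have hlift (t : unitInterval) : p (cov.liftPath σ e (σ.source.trans e.2.symm) t) = σ t :=
    congrFun (cov.liftPath_lifts σ e.1 (σ.source.trans e.2.symm)) t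
  have hzero := cov.liftPath_zero σ e.1 (σ.source.trans e.2.symm)
  set Γ := cov.liftPath σ e (σ.source.trans e.2.symm)
  have hΓ (t : unitInterval) : Γ t ∈ p ⁻¹' B := by
    rw [mem_preimage, hlift]; exact hσ (mem_range_self t)
  let Γ' : unitInterval → p ⁻¹' B := fun t => ⟨Γ t, hΓ t⟩
  have hΓ' : Continuous Γ' := Γ.continuous.subtype_mk _
  have hopen (V) (hV : V ∈ S) : IsOpen (Γ ⁻¹' V) := (hS V hV).1.preimage hΓ'
  obtain ⟨V, hV, hV0⟩ : Γ 0 ∈ ⋃₀ S := hcover ▸ hΓ 0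
  -- The other sheets are open too, so by connectedness the lift never leaves the sheet it starts
  -- in, and a sheet meets each fibre once.
  have hclopen : IsClopen (Γ ⁻¹' V) := by
    refine ⟨⟨?_⟩, hopen V hV⟩
    have : (Γ ⁻¹' V)ᶜ = ⋃ W ∈ S \ {V}, Γ ⁻¹' W := by
      ext t
      simp only [mem_compl_iff, mem_preimage, mem_iUnion, exists_prop, mem_sdiff, mem_singleton_iff]
      constructor
      · intro ht
        obtain ⟨W, hW, htW⟩ : Γ t ∈ ⋃₀ S := hcover ▸ hΓ t
        exact ⟨W, ⟨hW, by rintro rfl; exact ht htW⟩, htW⟩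
      · rintro ⟨W, ⟨hW, hne⟩, htW⟩ htV
        exact (hdisj hW hV hne).le_bot ⟨htW, htV⟩
    rw [this]
    exact isOpen_biUnion fun W hW => hopen W hW.1
  have huniv := hclopen.eq_univ ⟨0, hV0⟩
  have hV1 : Γ 1 ∈ V := (huniv.symm ▸ mem_univ 1 : (1 : unitInterval) ∈ Γ ⁻¹' V)
  obtain ⟨-, f, hf⟩ := hS V hV
  have heq : (⟨Γ 1, hV1⟩ : V) = ⟨Γ 0, hV0⟩ := by
    apply f.injective
    apply Subtype.ext
    rw [hf, hf]
    simp only [hlift, σ.source, σ.target]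
  apply Subtype.ext
  exact (congrArg Subtype.val heq).trans hzero

/-- A covering of a path connected, locally path connected space is trivial over an open set in
which all loops have trivial monodromy. -/
theorem trivialOver_of_monodromy_eq_id [PathConnectedSpace X] [LocallyPathConnectedSpace X]
    {B : Set X} (hB : IsOpen B)
    (h : ∀ (x : X) (σ : Path x x), range σ ⊆ B → cov.monodromy (.mk σ) = id) :
    CovSpectrum.TrivialOver p B := by
  obtain ⟨x₀⟩ : Nonempty X := inferInstance
  have := cov.isLocalHomeomorph.locallyPathConnectedSpace
  have hpB : IsOpen (p ⁻¹' B) := hB.preimage cov.continuous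
  -- The base point depends only on the component as a set, so points of one component share it.
  let c : Set X → X := fun C => Classical.epsilon (· ∈ C)
  have hc (b : X) (hb : b ∈ B) : JoinedIn B b (c (pathComponentIn B b)) :=
    Classical.epsilon_spec (p := (· ∈ pathComponentIn B b)) ⟨b, mem_pathComponentIn_self hb⟩
  have hβ (b : X) (hb : b ∈ B) (C : Set X) (hC : pathComponentIn B b = C) :
      ∃ β : Path b (c C), range β ⊆ B := by
    subst hC
    exact ⟨(hc b hb).somePath, range_subset_iff.mpr (hc b hb).somePath_mem⟩
  choose β hβB using hβ
  let α : ∀ x, Path x x₀ := fun x => PathConnectedSpace.somePath x x₀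
  let m (b : X) (hb : b ∈ B) : p ⁻¹' {b} → p ⁻¹' {x₀} :=
    cov.monodromy ((Path.Homotopic.Quotient.mk (β b hb _ rfl)).trans (.mk (α _)))
  have hm (b : X) (hb : b ∈ B) (C : Set X) (hC : pathComponentIn B b = C) (e) :
      m b hb e = cov.monodromy (.mk (α (c C))) (cov.monodromy (.mk (β b hb C hC)) e) := by
    subst hC
    exact cov.monodromy_trans_apply _ _ _
  -- Label of the sheet through `y`: transport `y` inside `B` to its component's base point, then on
  -- to the fibre over `x₀`.
  let ℓ : p ⁻¹' B → p ⁻¹' {x₀} := fun y => m (p y) y.2 ⟨y, rfl⟩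
  have hℓ (y y' : Y) (τ : Path y y') (hτ : ∀ t, τ t ∈ p ⁻¹' B) (hy : y ∈ p ⁻¹' B)
      (hy' : y' ∈ p ⁻¹' B) : ℓ ⟨y, hy⟩ = ℓ ⟨y', hy'⟩ := by
    let σ : Path (p y) (p y') := τ.map cov.continuous
    have hσ : ∀ t, σ t ∈ B := hτ
    have hcomp : pathComponentIn B (p y') = pathComponentIn B (p y) :=
      (pathComponentIn_congr (show JoinedIn B (p y) (p y') from ⟨σ, hσ⟩))
    have hmon : cov.monodromy (.mk σ) ⟨y, rfl⟩ = ⟨y', rfl⟩ := cov.monodromy_map (.mk τ)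
    change m _ _ _ = m _ _ _
    rw [hm (p y') hy' _ hcomp, hm (p y) hy _ rfl, ← hmon]
    congr 1
    rw [← cov.monodromy_trans_apply]
    -- This loop stays in `B`, so both routes to the base point have the same monodromy.
    have hloop := h _ ((σ.trans (β (p y') hy' _ hcomp)).trans (β (p y) hy _ rfl).symm) (by
      rw [Path.trans_range, Path.trans_range, Path.symm_range]
      exact union_subset (union_subset (range_subset_iff.mpr hσ) (hβB ..)) (hβB ..))
    have h2 := congrFun hloop ⟨y, rfl⟩
    rw [Path.Homotopic.Quotient.mk_trans, Path.Homotopic.Quotient.mk_trans,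
      Path.Homotopic.Quotient.mk_symm, cov.monodromy_trans_apply] at h2
    apply (cov.monodromy_bijective (Path.Homotopic.Quotient.mk (β (p y) hy _ rfl)).symm).1
    rw [h2, monodromy_symm_trans_apply, id]
  let V : p ⁻¹' {x₀} → Set Y := fun f => (↑) '' (ℓ ⁻¹' {f})
  have hVsub (f) : V f ⊆ p ⁻¹' B := by rintro _ ⟨y, -, rfl⟩; exact y.2
  have hVmem (f) (y : Y) (hy : y ∈ V f) : ℓ ⟨y, hVsub f hy⟩ = f := by
    obtain ⟨y, hy, rfl⟩ := hy; exact hy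
  have hVopen (f) : IsOpen (V f) := by
    rw [isOpen_iff_mem_nhds]
    intro y hy
    refine Filter.mem_of_superset ((hpB.pathComponentIn y).mem_nhds
      (mem_pathComponentIn_self (hVsub f hy))) ?_
    rintro y' ⟨τ, hτ⟩
    have hy' : y' ∈ p ⁻¹' B := by simpa using hτ 1
    exact ⟨⟨y', hy'⟩, (hℓ y y' τ hτ (hVsub f hy) hy').symm.trans (hVmem f y hy), rfl⟩
  refine ⟨range V, ?_, ?_, ?_⟩
  · rintro _ ⟨f, rfl⟩ _ ⟨g, rfl⟩ hne
    refine Set.disjoint_left.mpr fun y hf hg => hne ?_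
    rw [← hVmem f y hf, ← hVmem g y hg]
  · refine Subset.antisymm (sUnion_subset ?_) fun y hy => ?_
    · rintro _ ⟨f, rfl⟩; exact hVsub f
    · exact ⟨_, ⟨ℓ ⟨y, hy⟩, rfl⟩, ⟨y, hy⟩, rfl, rfl⟩
  · rintro _ ⟨f, rfl⟩
    refine ⟨(hVopen f).preimage continuous_subtype_val, ?_⟩
    let q : V f → B := fun y => ⟨p y, hVsub f y.2⟩
    have hmb (b : X) (hb : b ∈ B) : (m b hb).Bijective := cov.monodromy_bijective _
    have hq : q.Bijective := by
      constructor
      · rintro ⟨y, hy⟩ ⟨y', hy'⟩ hyy'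
        have hp : p y = p y' := congrArg Subtype.val hyy'
        have e1 := hVmem f y hy
        have e2 := hVmem f y' hy'
        have key (b : X) (hb : b ∈ B) (y : p ⁻¹' B) (hyb : p y = b) : ℓ y = m b hb ⟨y, hyb⟩ := by
          subst hyb; rfl
        rw [key (p y') (hVsub f hy') _ hp] at e1
        rw [key (p y') (hVsub f hy') _ rfl] at e2
        have := (hmb _ _).1 (e1.trans e2.symm)
        exact Subtype.ext (Subtype.mk.inj this)
      · rintro ⟨b, hb⟩
        obtain ⟨⟨y, hy⟩, hyf⟩ := (hmb b hb).2 f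
        have hyb : p y = b := hy
        subst hyb
        exact ⟨⟨y, ⟨y, hb⟩, hyf, rfl⟩, rfl⟩
    have hqc : Continuous q := (cov.continuous.comp continuous_subtype_val).subtype_mk _
    have hqo : IsOpenMap q := by
      intro W hW
      have : IsOpen (p '' (Subtype.val '' W)) :=
        cov.isOpenMap _ ((hVopen f).isOpenMap_subtype_val W hW)
      convert this.preimage (continuous_subtype_val (p := (· ∈ B))) using 1
      ext b
      constructor
      · rintro ⟨y, hy, rfl⟩; exact ⟨y, ⟨y, hy, rfl⟩, rfl⟩
      · rintro ⟨_, ⟨y, hy, rfl⟩, hyb⟩; exact ⟨y, hy, Subtype.ext hyb⟩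
    exact ⟨(Equiv.ofBijective q hq).toHomeomorphOfContinuousOpen hqc hqo, fun y => rfl⟩

end IsCoveringMap

/-! ### Covering triviality and the filtration -/

namespace CovSpectrum

/-- `δ`-triviality of a covering in terms of the kernel of its monodromy representation. -/
theorem deltaTrivial_iff {X Y : Type*} [MetricSpace X] [TopologicalSpace Y] [PathConnectedSpace X]
    [LocallyPathConnectedSpace X] {p : Y → X} (cov : IsCoveringMap p) (x₀ : X) (δ : ℝ≥0∞) :
    DeltaTrivial p δ ↔ ∀ (x c : X) (α : Path x₀ x) (σ : Path x x), range σ ⊆ Metric.eball c δ →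
      FundamentalGroup.fromPath (.mk ((α.trans σ).trans α.symm)) ∈ (cov.monodromyPerm x₀).ker := by
  have hker (g : FundamentalGroup X x₀) :
      g ∈ (cov.monodromyPerm x₀).ker ↔ cov.monodromy g = id := by
    rw [MonoidHom.mem_ker, ← cov.coe_monodromyPerm, ← Equiv.Perm.coe_one, DFunLike.coe_fn_eq]
  constructor
  · intro h x c α σ hσ
    rw [hker]
    exact (cov.monodromy_conj_eq_id_iff (.mk α) (.mk σ)).mpr
      (cov.monodromy_eq_id_of_trivialOver (h c) σ hσ)
  · intro h c
    refine cov.trivialOver_of_monodromy_eq_id Metric.isOpen_eball fun x σ hσ => ?_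
    let α := PathConnectedSpace.somePath x₀ x
    exact (cov.monodromy_conj_eq_id_iff (.mk α) (.mk σ)).mp ((hker _).mp (h x c α σ hσ))

theorem deltaTrivial_ofReal_iff {X Y : Type*} [MetricSpace X] [TopologicalSpace Y]
    [PathConnectedSpace X] [LocallyPathConnectedSpace X] {p : Y → X} (cov : IsCoveringMap p)
    (x₀ : X) (δ : Ioi (0 : ℝ)) :
    DeltaTrivial p (ENNReal.ofReal δ) ↔ fil x₀ δ ≤ (cov.monodromyPerm x₀).ker := by
  rw [deltaTrivial_iff cov x₀]
  simp only [Metric.eball_ofReal]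
  change _ ↔ Subgroup.closure _ ≤ _
  rw [Subgroup.closure_le]
  constructor
  · rintro h _ ⟨x, c, α, σ, hσ, rfl⟩
    exact h x c α σ hσ
  · intro h x c α σ hσ
    exact h ⟨x, c, α, σ, hσ, rfl⟩

end CovSpectrum

/-! ### The covering attached to a filtration step -/

namespace CovSpectrum

/-- The class of the loop `f * g⁻¹` modulo the subgroup `N` of the fundamental group. -/
noncomputable def loopClass {X : Type*} [TopologicalSpace X] {x₀ : X} (N : Subgroup (FundamentalGroup X x₀))
    {y : X} (f g : Path.Homotopic.Quotient x₀ y) : FundamentalGroup X x₀ ⧸ N :=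
  QuotientGroup.mk (FundamentalGroup.fromPath (f.trans g.symm))

section loopClass

variable {X : Type*} [TopologicalSpace X] {x₀ : X} (N : Subgroup (FundamentalGroup X x₀)) {y z : X}

theorem loopClass_eq_one_iff [N.Normal] (f g : Path.Homotopic.Quotient x₀ y) :
    loopClass N f g = 1 ↔ FundamentalGroup.fromPath (f.trans g.symm) ∈ N :=
  QuotientGroup.eq_one_iff _

@[simp]
theorem loopClass_self [N.Normal] (f : Path.Homotopic.Quotient x₀ y) : loopClass N f f = 1 := by
  rw [loopClass_eq_one_iff, Path.Homotopic.Quotient.trans_symm]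
  exact N.one_mem

theorem loopClass_mul [N.Normal] (f g k : Path.Homotopic.Quotient x₀ y) :
    loopClass N g k * loopClass N f g = loopClass N f k := by
  refine congrArg (QuotientGroup.mk (s := N))
    (a₁ := (f.trans g.symm).trans (g.trans k.symm)) (a₂ := f.trans k.symm) ?_
  rw [Path.Homotopic.Quotient.trans_assoc, ← Path.Homotopic.Quotient.trans_assoc g.symm,
    Path.Homotopic.Quotient.symm_trans, Path.Homotopic.Quotient.refl_trans]

theorem symm_trans_rev (f : Path.Homotopic.Quotient x₀ y) (s : Path.Homotopic.Quotient y z) :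
    (f.trans s).symm = s.symm.trans f.symm := by
  induction f with | mk f
  induction s with | mk s
  rw [← Path.Homotopic.Quotient.mk_trans, ← Path.Homotopic.Quotient.mk_symm, Path.trans_symm]
  rfl

theorem loopClass_trans (f g : Path.Homotopic.Quotient x₀ y) (s : Path.Homotopic.Quotient y z) :
    loopClass N (f.trans s) (g.trans s) = loopClass N f g := by
  rw [loopClass, loopClass, symm_trans_rev, Path.Homotopic.Quotient.trans_assoc,
    ← Path.Homotopic.Quotient.trans_assoc s, Path.Homotopic.Quotient.trans_symm,
    Path.Homotopic.Quotient.refl_trans]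

theorem loopClass_congr [N.Normal] {f f' g g' : Path.Homotopic.Quotient x₀ y}
    (hf : loopClass N f f' = 1) (hg : loopClass N g g' = 1) :
    loopClass N f' g' = loopClass N f g := by
  have h1 := loopClass_mul N f g g'
  have h2 := loopClass_mul N f f' g'
  rw [hg, one_mul] at h1
  rw [hf, mul_one] at h2
  exact h2.trans h1.symm

end loopClass

variable {X : Type u} [MetricSpace X]

instance fil_normal (x₀ : X) (δ : Ioi (0 : ℝ)) : (fil x₀ δ).Normal := by
  refine ⟨fun n hn g => ?_⟩
  suffices h : Subgroup.closure (smallClasses x₀ δ) ≤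
      (Subgroup.closure (smallClasses x₀ δ)).comap (MulAut.conj g).toMonoidHom from h hn
  rw [Subgroup.closure_le]
  rintro _ ⟨x, c, α, σ, hσ, rfl⟩
  obtain ⟨γ, rfl⟩ := Path.Homotopic.Quotient.mk_surjective g
  refine Subgroup.subset_closure ⟨x, c, γ.symm.trans α, σ, hσ, ?_⟩
  -- In a product of classes the right factor is traversed first, so conjugating by `γ` prefixes
  -- `γ.symm`.
  change (Path.Homotopic.Quotient.mk γ).symm.trans
    ((Path.Homotopic.Quotient.mk ((α.trans σ).trans α.symm)).trans (.mk γ)) = _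
  simp only [Path.trans_symm, Path.symm_symm, Path.Homotopic.Quotient.mk_trans,
    Path.Homotopic.Quotient.mk_symm, Path.Homotopic.Quotient.trans_assoc]

section Cover

variable [PathConnectedSpace X] (x₀ : X) (δ : Ioi (0 : ℝ))

open Classical in
/-- A class of paths from `x₀` to `x` which, if possible, ends with a path from `i` to `x` inside
the ball of radius `δ` around `i`. -/
noncomputable def ballPath (i x : X) : Path.Homotopic.Quotient x₀ x :=
  if h : JoinedIn (Metric.ball i δ) i x then
    .mk ((PathConnectedSpace.somePath x₀ i).trans h.somePath)
  else .mk (PathConnectedSpace.somePath x₀ x)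

/-- Both paths share the initial leg from `x₀` to `i`; what remains is a loop at `i` inside the
ball, hence a generator of the subgroup. -/
theorem loopClass_ballPath_trans {i x x' : X} (hx : JoinedIn (Metric.ball i δ) i x)
    (s : Path x x') (hs : range s ⊆ Metric.ball i δ) :
    loopClass (fil x₀ δ) ((ballPath x₀ δ i x).trans (.mk s)) (ballPath x₀ δ i x') = 1 := by
  have hx' : JoinedIn (Metric.ball i δ) i x' :=
    hx.trans ⟨s, fun t => hs (mem_range_self t)⟩
  rw [loopClass_eq_one_iff]
  refine Subgroup.subset_closure ⟨i, i, PathConnectedSpace.somePath x₀ i,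
    (hx.somePath.trans s).trans hx'.somePath.symm, ?_, ?_⟩
  · rw [Path.trans_range, Path.trans_range, Path.symm_range]
    exact union_subset (union_subset (range_subset_iff.mpr hx.somePath_mem) hs)
      (range_subset_iff.mpr hx'.somePath_mem)
  · rw [ballPath, ballPath, dif_pos hx, dif_pos hx']
    simp only [Path.Homotopic.Quotient.mk_trans, symm_trans_rev,
      Path.Homotopic.Quotient.mk_symm, Path.Homotopic.Quotient.trans_assoc]

instance fil_quotient_topology : TopologicalSpace (FundamentalGroup X x₀ ⧸ fil x₀ δ) := ⊥

instance fil_quotient_discrete : DiscreteTopology (FundamentalGroup X x₀ ⧸ fil x₀ δ) := ⟨rfl⟩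

variable [LocallyPathConnectedSpace X]

/-- The gluing data for the covering space associated with `fil x₀ δ`. -/
noncomputable def coverCore : FiberBundleCore X X (FundamentalGroup X x₀ ⧸ fil x₀ δ) where
  baseSet i := pathComponentIn (Metric.ball i δ) i
  isOpen_baseSet i := Metric.isOpen_ball.pathComponentIn i
  indexAt x := x
  mem_baseSet_at x := mem_pathComponentIn_self (Metric.mem_ball_self δ.2)
  coordChange i j x v := loopClass (fil x₀ δ) (ballPath x₀ δ i x) (ballPath x₀ δ j x) * v
  coordChange_self i x _ v := by rw [loopClass_self, one_mul]
  continuousOn_coordChange i j := by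
    rintro ⟨x, v⟩ ⟨⟨hi, hj⟩, -⟩
    refine ContinuousAt.continuousWithinAt ?_
    refine (continuousAt_const (y := loopClass (fil x₀ δ) (ballPath x₀ δ i x)
      (ballPath x₀ δ j x) * v)).congr ?_
    have hU : IsOpen (Metric.ball i δ ∩ Metric.ball j (δ : ℝ)) :=
      Metric.isOpen_ball.inter Metric.isOpen_ball
    have hxU : x ∈ Metric.ball i δ ∩ Metric.ball j (δ : ℝ) :=
      ⟨pathComponentIn_subset hi, pathComponentIn_subset hj⟩
    filter_upwards [prod_mem_nhds ((hU.pathComponentIn x).mem_nhds (mem_pathComponentIn_self hxU))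
      (show {v} ∈ 𝓝 v from mem_nhds_discrete.mpr rfl)]
    rintro ⟨x', v'⟩ ⟨⟨s, hs⟩, rfl⟩
    -- The path `s` lies in both balls, so moving along it extends both reference paths by `s`,
    -- which cancels: transition functions are locally constant.
    have h1 := loopClass_ballPath_trans x₀ δ hi s (range_subset_iff.mpr fun t => (hs t).1)
    have h2 := loopClass_ballPath_trans x₀ δ hj s (range_subset_iff.mpr fun t => (hs t).2)
    dsimp only
    rw [loopClass_congr _ h1 h2, loopClass_trans]
  coordChange_comp i j k x _ v := by rw [← mul_assoc, loopClass_mul]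

theorem isCoveringMap_coverCore : IsCoveringMap (coverCore x₀ δ).proj :=
  IsCoveringMap.mk _ _ (fun x => (coverCore x₀ δ).localTrivAt x)
    fun x => (coverCore x₀ δ).mem_localTrivAt_baseSet x

variable {x₀ δ} in
/-- The fibre coordinate of a point of the covering space. -/
def coverSnd (y : (coverCore x₀ δ).TotalSpace) : FundamentalGroup X x₀ ⧸ fil x₀ δ := y.2

variable {x₀ δ} in
theorem eventually_coverSnd_eq (y : (coverCore x₀ δ).TotalSpace) : ∀ᶠ z in 𝓝 y,
    loopClass (fil x₀ δ) (ballPath x₀ δ z.1 z.1) (ballPath x₀ δ y.1 z.1) * coverSnd z =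
      coverSnd y := by
  let T := (coverCore x₀ δ).localTrivAt y.1
  have hT : ContinuousAt T y := T.continuousAt ((coverCore x₀ δ).mem_localTrivAt_baseSet y.1)
  have hT2 : ContinuousAt (fun z => (T z).2) y := continuousAt_snd.comp hT
  have hmem : {(T y).2} ∈ 𝓝 (T y).2 := mem_nhds_discrete.mpr rfl
  filter_upwards [hT2 hmem] with z hz
  have hz' : (T z).2 = (T y).2 := hz
  refine Eq.trans hz' ?_
  change loopClass (fil x₀ δ) (ballPath x₀ δ y.1 y.1) (ballPath x₀ δ y.1 y.1) * coverSnd y = _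
  rw [loopClass_self, one_mul]

/-- A path in the covering space is determined by its starting point and its projection. -/
theorem coverSnd_eq_of_path {y y' : (coverCore x₀ δ).TotalSpace} (Γ : Path y y') :
    loopClass (fil x₀ δ) (ballPath x₀ δ y'.1 y'.1) ((ballPath x₀ δ y.1 y.1).trans
      (.mk (Γ.map (isCoveringMap_coverCore x₀ δ).continuous))) * coverSnd y' = coverSnd y := by
  rcases Γ with ⟨Γ, rfl, rfl⟩
  let γ : Path (Γ 0).1 (Γ 1).1 :=
    ⟨⟨fun t => (Γ t).1, (isCoveringMap_coverCore x₀ δ).continuous.comp Γ.continuous⟩, rfl, rfl⟩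
  let Q (t : unitInterval) : Path.Homotopic.Quotient x₀ (Γ t).1 :=
    (ballPath x₀ δ (Γ 0).1 (Γ 0).1).trans (.mk (γ.subpath 0 t))
  -- The fibre coordinate at time `t`, transported back to the start along the projected path; being
  -- locally constant, it is constant.
  let L : unitInterval → FundamentalGroup X x₀ ⧸ fil x₀ δ := fun t =>
    loopClass (fil x₀ δ) (ballPath x₀ δ (Γ t).1 (Γ t).1) (Q t) * coverSnd (Γ t)
  have hL : IsLocallyConstant L := by
    rw [IsLocallyConstant.iff_eventually_eq]
    intro t₀
    have hball : γ ⁻¹' Metric.ball (γ t₀) δ ∈ 𝓝 t₀ :=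
      γ.continuous.continuousAt (Metric.ball_mem_nhds _ δ.2)
    have hIcc : ∀ᶠ t in 𝓝 t₀, uIcc t₀ t ⊆ γ ⁻¹' Metric.ball (γ t₀) δ :=
      ((tendsto_const_nhds (x := t₀)).uIcc Filter.tendsto_id).eventually
        (Filter.eventually_smallSets.mpr ⟨_, hball, fun _ h => h⟩)
    filter_upwards [hIcc, Γ.continuous.continuousAt.eventually (eventually_coverSnd_eq (Γ t₀))]
      with t ht hv
    have hs : range (γ.subpath t₀ t) ⊆ Metric.ball (γ t₀) δ := by
      rw [Path.range_subpath]
      exact image_subset_iff.mpr ht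
    have hQ : Q t = (Q t₀).trans (.mk (γ.subpath t₀ t)) := by
      rw [Path.Homotopic.Quotient.trans_assoc, ← Path.Homotopic.Quotient.mk_trans]
      exact congrArg (ballPath x₀ δ (Γ 0).1 (Γ 0).1).trans (Path.Homotopic.Quotient.eq.mpr
        ⟨(Path.Homotopy.subpathTransSubpath γ 0 t₀ t).symm⟩)
    have hA := loopClass_ballPath_trans x₀ δ
      (JoinedIn.refl (Metric.mem_ball_self δ.2)) (γ.subpath t₀ t) hs
    have hcls := loopClass_congr (fil x₀ δ) hA (loopClass_self _ (Q t))
    change loopClass (fil x₀ δ) _ (Q t) * coverSnd (Γ t) =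
      loopClass (fil x₀ δ) _ (Q t₀) * coverSnd (Γ t₀)
    rw [← loopClass_mul _ _ (ballPath x₀ δ (Γ t₀).1 (Γ t).1) (Q t), mul_assoc, hv]
    refine congrArg (· * _) (hcls.trans ?_)
    rw [hQ, loopClass_trans]
    rfl
  have h01 : L 1 = L 0 := hL.apply_eq_of_isPreconnected isPreconnected_univ trivial trivial
  have h0 : L 0 = coverSnd (Γ 0) := by
    have : Q 0 = ballPath x₀ δ (Γ 0).1 (Γ 0).1 := by
      change Path.Homotopic.Quotient.trans _ _ = _
      rw [Path.subpath_self]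
      exact Path.Homotopic.Quotient.trans_refl _
    change loopClass _ _ (Q 0) * _ = _
    rw [this, loopClass_self, one_mul]
  have h1 : Q 1 = (ballPath x₀ δ (Γ 0).1 (Γ 0).1).trans (.mk γ) := by
    change Path.Homotopic.Quotient.trans _ _ = _
    rw [Path.subpath_zero_one]
    rfl
  rw [show L 1 = loopClass _ _ (Q 1) * coverSnd (Γ 1) from rfl, h1, h0] at h01
  exact h01

/-- Monodromy multiplies the fibre coordinate on the left by a conjugate of `g` or its inverse, so
by normality it is trivial iff `g` lies in the subgroup; one point of the fibre suffices to test
this. -/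
theorem ker_monodromyPerm_coverCore :
    ((isCoveringMap_coverCore x₀ δ).monodromyPerm x₀).ker = fil x₀ δ := by
  have hcov := isCoveringMap_coverCore x₀ δ
  have hnorm := fil_normal x₀ δ
  let b : FundamentalGroup X x₀ := ballPath x₀ δ x₀ x₀
  let pt (v : FundamentalGroup X x₀ ⧸ fil x₀ δ) : (coverCore x₀ δ).proj ⁻¹' {x₀} := ⟨⟨x₀, v⟩, rfl⟩
  -- The chosen path `b` at `x₀` need not be constant; normality removes it.
  have hconj (g : FundamentalGroup X x₀) :
      loopClass (fil x₀ δ) b.toPath (b.toPath.trans g.toPath) = 1 ↔ g ∈ fil x₀ δ := by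
    rw [loopClass_eq_one_iff, symm_trans_rev, ← inv_mem_iff (x := g)]
    change (b⁻¹ * g⁻¹) * b ∈ _ ↔ _
    rw [hnorm.mem_comm_iff, mul_inv_cancel_left]
  have hsnd (g : FundamentalGroup X x₀) (v : FundamentalGroup X x₀ ⧸ fil x₀ δ) :
      ∃ w, hcov.monodromy g (pt v) = pt w ∧
        loopClass (fil x₀ δ) b.toPath (b.toPath.trans g.toPath) * w = v := by
    have hmap := hcov.map_liftPathQuotient g (pt v)
    generalize hcov.liftPathQuotient g (pt v) = Γ at hmap
    generalize hcov.monodromy g (pt v) = e at Γ hmap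
    obtain ⟨⟨z, w⟩, hz⟩ := e
    obtain rfl : z = x₀ := hz
    refine ⟨w, rfl, ?_⟩
    obtain ⟨Γ, rfl⟩ := Path.Homotopic.Quotient.mk_surjective Γ
    have := coverSnd_eq_of_path _ δ Γ
    have hg : g = _ := (hmap.trans (Path.Homotopic.Quotient.cast_rfl_rfl g)).symm
    rw [hg]
    exact this
  ext g
  rw [MonoidHom.mem_ker, ← hconj]
  constructor
  · intro h
    obtain ⟨w, hw, hw'⟩ := hsnd g 1
    have h1 : hcov.monodromy g (pt 1) = pt 1 := congrArg (· (pt 1)) h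
    rw [h1] at hw
    have : w = 1 := 
      (congrArg (fun y : (coverCore x₀ δ).proj ⁻¹' {x₀} => coverSnd y.1) hw).symm
    rwa [this, mul_one] at hw'
  · intro h
    ext e : 1
    obtain ⟨⟨z, v⟩, hz⟩ := e
    obtain rfl : z = x₀ := hz
    obtain ⟨w, hw, hw'⟩ := hsnd g v
    rw [h, one_mul] at hw'
    subst hw'
    exact hw

end Cover

end CovSpectrum

/-! ### Covering radii and jumps -/

namespace CovSpectrum

/-- A compact subset of an open extended ball is contained in a smaller ball of positive real
radius. -/
theorem exists_subset_ball_of_isCompact {X : Type*} [MetricSpace X] {K : Set X} (hK : IsCompact K)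
    {c : X} {r : ℝ≥0∞} (hr : 0 < r) (h : K ⊆ Metric.eball c r) :
    ∃ δ : ℝ, 0 < δ ∧ ENNReal.ofReal δ < r ∧ K ⊆ Metric.ball c δ := by
  obtain ⟨s, hs, hsr⟩ : ∃ s < r, ∀ x ∈ K, edist x c ≤ s := by
    rcases K.eq_empty_or_nonempty with rfl | hne
    · exact ⟨0, hr, by simp⟩
    · obtain ⟨x, hx, hmax⟩ := hK.exists_isMaxOn hne
        (f := fun x => edist x c) (by fun_prop)
      exact ⟨edist x c, h hx, fun y hy => hmax hy⟩
  obtain ⟨t, hst, htr⟩ := ENNReal.lt_iff_exists_nnreal_btwn.mp hs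
  refine ⟨t, ?_, by simpa using htr, fun x hx => ?_⟩
  · exact_mod_cast (zero_le.trans_lt hst : (0 : ℝ≥0∞) < t)
  · rw [← Metric.eball_coe]
    exact (hsr x hx).trans_lt hst

variable {X : Type u} [MetricSpace X] [PathConnectedSpace X] [LocallyPathConnectedSpace X]

section Covering

variable {Y : Type*} [TopologicalSpace Y] {p : Y → X} (cov : IsCoveringMap p) (x₀ : X)
include cov

theorem DeltaTrivial.mono {δ ε : ℝ≥0∞} (h : DeltaTrivial p ε) (hle : δ ≤ ε) :
    DeltaTrivial p δ := by
  intro c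
  rw [deltaTrivial_iff cov c] at h
  exact (deltaTrivial_iff cov c δ).mpr
    (fun x c' α σ hσ => h x c' α σ (hσ.trans (Metric.eball_subset_eball hle))) c

/-- The supremum defining a nonzero covering radius is attained. -/
theorem deltaTrivial_covRadius (h0 : covRadius p ≠ 0) : DeltaTrivial p (covRadius p) := by
  intro c
  refine (deltaTrivial_iff cov c _).mpr (fun x c' α σ hσ => ?_) c
  -- The loop already fits in a ball of radius strictly below the supremum.
  obtain ⟨δ, -, hδ, hσδ⟩ := exists_subset_ball_of_isCompact
    (isCompact_range σ.continuous) (pos_iff_ne_zero.mpr h0) hσ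
  obtain ⟨ε, hε, hδε⟩ := lt_sSup_iff.mp hδ
  refine (deltaTrivial_iff cov c _).mp (DeltaTrivial.mono cov hε hδε.le) x c' α σ ?_
  rwa [Metric.eball_ofReal]

theorem covRadius_ne_top (h : ¬ TrivialOver p univ) : covRadius p ≠ ⊤ := by
  intro htop
  obtain ⟨c⟩ : Nonempty X := inferInstance
  have := deltaTrivial_covRadius cov (by simp [htop]) c
  rw [htop, Metric.eball_top] at this
  exact h this

theorem covRadius_mem_jump (h : ¬ TrivialOver p univ) (h0 : covRadius p ≠ 0) :
    ∃ δ ∈ Jump (fil x₀), ENNReal.ofReal (δ : ℝ) = covRadius p := by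
  have htop := covRadius_ne_top cov h
  have heq := ENNReal.ofReal_toReal htop
  let δ : Ioi (0 : ℝ) := ⟨(covRadius p).toReal, ENNReal.toReal_pos h0 htop⟩
  refine ⟨δ, fun ε hlt hfil => ?_, heq⟩
  have hδ : DeltaTrivial p (ENNReal.ofReal δ) := heq ▸ deltaTrivial_covRadius cov h0
  rw [deltaTrivial_ofReal_iff cov x₀, hfil, ← deltaTrivial_ofReal_iff cov x₀] at hδ
  have hle : ENNReal.ofReal ε ≤ covRadius p := le_sSup hδ
  rw [← heq, ENNReal.ofReal_le_ofReal_iff δ.2.le] at hle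
  exact not_lt_of_ge hle hlt

end Covering

theorem mem_covSpec_of_mem_jump (x₀ : X) {δ : Ioi (0 : ℝ)} (hδ : δ ∈ Jump (fil x₀)) :
    ENNReal.ofReal (δ : ℝ) ∈ CovSpec X := by
  have cov := isCoveringMap_coverCore x₀ δ
  have hdelta (ε : Ioi (0 : ℝ)) :
      DeltaTrivial (coverCore x₀ δ).proj (ENNReal.ofReal ε) ↔ fil x₀ ε ≤ fil x₀ δ := by
    rw [deltaTrivial_ofReal_iff cov x₀, ker_monodromyPerm_coverCore]
  have hbound (ε : ℝ≥0∞) (hε : DeltaTrivial (coverCore x₀ δ).proj ε) :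
      ε ≤ ENNReal.ofReal (δ : ℝ) := by
    by_contra! hlt
    obtain ⟨t, hδt, htε⟩ := ENNReal.lt_iff_exists_nnreal_btwn.mp hlt
    have hδt' : (δ : ℝ) < t := by
      rwa [← ENNReal.ofReal_coe_nnreal, ENNReal.ofReal_lt_ofReal_iff_of_nonneg δ.2.le] at hδt
    let ε' : Ioi (0 : ℝ) := ⟨t, lt_trans δ.2 hδt'⟩
    have hε' : DeltaTrivial (coverCore x₀ δ).proj (ENNReal.ofReal ε') :=
      DeltaTrivial.mono cov hε (by simpa [ε'] using htε.le)
    exact hδ ε' hδt' (le_antisymm ((fil x₀).monotone hδt'.le) ((hdelta ε').mp hε'))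
  refine ⟨_, inferInstance, (coverCore x₀ δ).proj, cov, cov.constantDegree, fun h => ?_, ?_⟩
  -- A trivial covering would be `∞`-trivial, against the finite bound.
  · have htop := hbound ⊤ fun c => by rwa [Metric.eball_top]
    exact ENNReal.ofReal_ne_top (top_le_iff.mp htop)
  · exact le_antisymm (sSup_le hbound) (le_sSup ((hdelta δ).mpr le_rfl))

end CovSpectrum

theorem mainTheorem6 {X : Type u} [MetricSpace X] [ConnectedSpace X] [LocallyPathConnectedSpace X]
    (x₀ : X) :
    CovSpectrum.CovSpec X \ {0} =
      (fun δ : Ioi (0 : ℝ) => ENNReal.ofReal (δ : ℝ)) '' CovSpectrum.Jump (CovSpectrum.fil x₀) := by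
  have : PathConnectedSpace X := .of_locallyPathConnectedSpace
  ext r
  constructor
  · rintro ⟨⟨Y, _, p, cov, -, hp, rfl⟩, h0⟩
    exact CovSpectrum.covRadius_mem_jump cov x₀ hp h0
  · rintro ⟨δ, hδ, rfl⟩
    exact ⟨CovSpectrum.mem_covSpec_of_mem_jump x₀ hδ, (ENNReal.ofReal_pos.mpr δ.2).ne'⟩
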